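/- Fix $\theta\in(0,1]$. For $n\ge 1$ and $x\in\{0,1\}^n$ let $S(x)=\sum_i x_i$ and $\pi_n(x)=\theta^{S(x)}(1+\theta)^{-n}$, and let $P_n$ be the transition matrix of the lazy random-walk Metropolis chain on $\{0,1\}^n$ with target $\pi_n$: at each step, with probability $1/2$ stay put; otherwise choose one of the $n$ neighbours $y$ of the current state $x$ (the states differing from $x$ in exactly one coordinate) uniformly at random, move to $y$ with probability $\min(1,\pi_n(y)/\pi_n(x))$, and stay at $x$ if the move is rejected. Let $$d_n(t)=\max_{x\in\{0,1\}^n}\ \max_{A\subseteq\{0,1\}^n}\bigl(P_n^t(x,A)-\pi_n(A)\bigr),$$ let $t^{(n)}_{\mathrm{mix}}(\varepsilon)=\min\{t\ge 0: d_n(t)\le\varepsilon\}$, and write $t^{(n)}_{\mathrm{mix}}=t^{(n)}_{\mathrm{mix}}(1/4)$. At a real time $s$ set $d_n(s)=d_n(\max(\lfloor s\rfloor,0))$. Then the sequence of chains has cutoff at $t_n:=\frac{1}{1+\theta}\,n\log n$ with a window of size $n$. That is: for every $\varepsilon\in(0,1)$, $$\lim_{n\to\infty}\frac{t^{(n)}_{\mathrm{mix}}(\varepsilon)}{t^{(n)}_{\mathrm{mix}}(1-\varepsilon)}=1;$$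 moreover $t^{(n)}_{\mathrm{mix}}\sim t_n$ as $n\to\infty$; and, both for $T_n=t_n$ and for $T_n=t^{(n)}_{\mathrm{mix}}$, one has $n=o(T_n)$, $$\lim_{\alpha\to\infty}\liminf_{n\to\infty} d_n(T_n-\alpha n)=1\qquad\text{and}\qquad \lim_{\alpha\to\infty}\limsup_{n\to\infty} d_n(T_n+\alpha n)=0.$$ -/

import Mathlib

open Filter Topology Asymptotics

noncomputable section

/-! ### Finite Markov chains: total variation, distance to stationarity, mixing time -/

section MarkovChain

variable {X : Type*} [Fintype X] [DecidableEq X]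

/-- Total variation distance of two probability vectors on a finite set:
`max_{A ⊆ X} (μ(A) - ν(A))`. -/
def tvDist (μ ν : X → ℝ) : ℝ :=
  ⨆ A : Finset X, (∑ x ∈ A, μ x - ∑ x ∈ A, ν x)

/-- Worst-case distance to stationarity `d(t) = max_x ‖P^t(x, ·) - π‖_TV`. -/
def distToStationarity (P : Matrix X X ℝ) (π : X → ℝ) (t : ℕ) : ℝ :=
  ⨆ x : X, tvDist ((P ^ t) x) π

end MarkovChain

/-- The mixing time `t_mix(ε) = min {t ≥ 0 : d(t) ≤ ε}` for a distance function `d`. -/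
def mixingTime (d : ℕ → ℝ) (ε : ℝ) : ℕ :=
  sInf {t : ℕ | d t ≤ ε}

/-! ### Cutoff -/

/-- A sequence of chains with distance functions `d n` has a cutoff:
`t_mix(ε) / t_mix(1 - ε) → 1` for every `ε ∈ (0, 1)`. -/
def HasCutoff (d : ℕ → ℕ → ℝ) : Prop :=
  ∀ ε : ℝ, 0 < ε → ε < 1 →
    Tendsto (fun n => (mixingTime (d n) ε : ℝ) / (mixingTime (d n) (1 - ε) : ℝ)) atTop (𝓝 1)

/-- The transition of `d n` from `1` to `0` takes place around time `t n`, within a window of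
size `w n = o(t n)`. A discrete-time chain is evaluated at a real time `s` as at `⌊s⌋`
(and at time `0` if `s < 0`). -/
def HasWindowAround (d : ℕ → ℕ → ℝ) (t w : ℕ → ℝ) : Prop :=
  w =o[atTop] t ∧
  Tendsto (fun α : ℝ => liminf (fun n => d n ⌊t n - α * w n⌋₊) atTop) atTop (𝓝 1) ∧
  Tendsto (fun α : ℝ => limsup (fun n => d n ⌊t n + α * w n⌋₊) atTop) atTop (𝓝 0)

/-- Cutoff at `t` with a window of size `w`: there is a cutoff, with window `w` around the
mixing times `t_mix = t_mix(1/4)`; these are asymptotic to `t`; and the window statement also holds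
around `t` itself. -/
structure HasCutoffAtWithWindow (d : ℕ → ℕ → ℝ) (t w : ℕ → ℝ) : Prop where
  cutoff : HasCutoff d
  window_mixingTime : HasWindowAround d (fun n => (mixingTime (d n) (1 / 4) : ℝ)) w
  location : (fun n => (mixingTime (d n) (1 / 4) : ℝ)) ~[atTop] t
  window : HasWindowAround d t w

/-! ### The random walk Metropolis chain on the hypercube -/

/-- Number of ones `S(x)`. -/
def numOnes {n : ℕ} (x : Fin n → Bool) : ℕ :=
  (Finset.univ.filter (fun i => x i = true)).card

/-- Off-diagonal transition probabilities of the random walk Metropolis chain for `π`: propose one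
of the `n` neighbours uniformly, accept it with probability `min(1, π(y) / π(x))`. -/
def metropolisMove {n : ℕ} (π : (Fin n → Bool) → ℝ) (x y : Fin n → Bool) : ℝ :=
  if hammingDist x y = 1 then 1 / (n : ℝ) * min 1 (π y / π x) else 0

/-- Transition matrix of the (non-lazy) random walk Metropolis chain for `π` on `{0,1}^n`: the
remaining mass (rejected proposals) is put on the diagonal. -/
def metropolis {n : ℕ} (π : (Fin n → Bool) → ℝ) : Matrix (Fin n → Bool) (Fin n → Bool) ℝ :=
  Matrix.of fun x y =>
    if x = y then 1 - ∑ z, metropolisMove π x z else metropolisMove π x y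

/-- The lazy version: stay put with probability `1/2`, otherwise make a Metropolis step. -/
def lazyMetropolis {n : ℕ} (π : (Fin n → Bool) → ℝ) :
    Matrix (Fin n → Bool) (Fin n → Bool) ℝ :=
  (1 / 2 : ℝ) • (1 : Matrix (Fin n → Bool) (Fin n → Bool) ℝ) + (1 / 2 : ℝ) • metropolis π

/-- The target distribution `π(x) = θ^{S(x)} (1 + θ)^{-n}` on `{0,1}^n`. -/
def erTarget (θ : ℝ) (n : ℕ) (x : Fin n → Bool) : ℝ :=
  θ ^ numOnes x * ((1 + θ) ^ n)⁻¹

end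

/-!
At each step the chain picks a site uniformly and updates it by a two-state chain, independently of
the other sites: `1` flips with probability `1 / 2` and `0` flips with probability `θ / 2`, because
`θ ≤ 1`. Hence the products `eigenfun θ S`, over sets `S` of sites, of the one-site eigenfunction
are eigenfunctions of the transition matrix, with eigenvalues `1 - |S| (1 + θ) / (2 n) ≥ 0`
(`lazyMetropolis_mulVec_eigenfun`). They are complete (`sum_eigenfun_mul_eigenfun`), which yields
the spectral formula `pow_apply_eq_sum` for the powers of the transition matrix.

Upper bound (`distToStationarity_le_sqrt`). By Cauchy–Schwarz the squared total variation distance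
is at most the `χ²`-divergence, which is a sum of `eigenval ^ (2 t)` over nonempty `S`, with weights
at most `θ⁻¹ ^ |S|`. It is at most `(1 + q / θ) ^ n - 1` with `q = exp (-(1 + θ) t / n)`, hence
small once `n * q` is, that is, a large multiple of `n` steps after `n log n / (1 + θ)`.

Lower bound (`one_sub_le_distToStationarity`). The sum of the one-site eigenfunctions has, from the
all-ones state, mean `m = n λ ^ t` with `λ = eigenval θ n 1`, and variance at most `n`, because
distinct sites are nonpositively correlated (`eigenval θ n 2 ≤ λ ^ 2`); under the target its second
moment is at most `n`. Chebyshev's inequality (`one_sub_le_tvDist`) bounds the distance below by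
`1 - 8 n / m ^ 2`, which is close to `1` a large multiple of `n` steps before `n log n / (1 + θ)`.

Both bounds hold uniformly over all later, respectively earlier, times (`NearZeroAfter`,
`NearOneBefore`). These two properties locate every mixing time within `O(n)` of
`n log n / (1 + θ)` (`isBigO_mixingTime_sub`), and give the window statement around every sequence
of times with this property (`hasWindowAround_of_isBigO`), without monotonicity of the distance.
-/

/-! ### Bounds on the total variation distance -/

section TotalVariation

variable {X : Type*} [Fintype X]

theorem sum_sub_sum_le_tvDist (μ ν : X → ℝ) (A : Finset X) :
    ∑ x ∈ A, μ x - ∑ x ∈ A, ν x ≤ tvDist μ ν :=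
  le_ciSup (f := fun A : Finset X => ∑ x ∈ A, μ x - ∑ x ∈ A, ν x) (Set.finite_range _).bddAbove A

theorem tvDist_nonneg (μ ν : X → ℝ) : 0 ≤ tvDist μ ν := by
  simpa using sum_sub_sum_le_tvDist μ ν ∅

theorem tvDist_le_one {μ ν : X → ℝ} (hμ : ∀ x, 0 ≤ μ x) (hμ1 : ∑ x, μ x = 1)
    (hν : ∀ x, 0 ≤ ν x) : tvDist μ ν ≤ 1 := by
  refine ciSup_le fun A => ?_
  have h1 : ∑ x ∈ A, μ x ≤ ∑ x, μ x :=
    Finset.sum_le_sum_of_subset_of_nonneg (Finset.subset_univ A) fun x _ _ => hμ x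
  have h2 : 0 ≤ ∑ x ∈ A, ν x := Finset.sum_nonneg fun x _ => hν x
  linarith

/-- Total variation is controlled by the `χ²`-divergence, by Cauchy–Schwarz. -/
theorem tvDist_le_sqrt {μ ν : X → ℝ} (hμ1 : ∑ x, μ x = 1) (hν : ∀ x, 0 < ν x)
    (hν1 : ∑ x, ν x = 1) : tvDist μ ν ≤ √(∑ x, μ x ^ 2 / ν x - 1) := by
  refine ciSup_le fun A => Real.le_sqrt_of_sq_le ?_
  have hchi : ∑ x, (μ x - ν x) ^ 2 / ν x = ∑ x, μ x ^ 2 / ν x - 1 := by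
    have : ∀ x, (μ x - ν x) ^ 2 / ν x = μ x ^ 2 / ν x - 2 * μ x + ν x := fun x => by
      have := (hν x).ne'
      field_simp
      ring
    simp only [this, Finset.sum_add_distrib, Finset.sum_sub_distrib, ← Finset.mul_sum, hμ1, hν1]
    ring
  have hA : ∑ x ∈ A, ν x ≤ 1 :=
    hν1 ▸ Finset.sum_le_sum_of_subset_of_nonneg (Finset.subset_univ A) fun x _ _ => (hν x).le
  have hcs : (∑ x ∈ A, (μ x - ν x)) ^ 2 ≤ (∑ x ∈ A, (μ x - ν x) ^ 2 / ν x) * ∑ x ∈ A, ν x :=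
    Finset.sum_sq_le_sum_mul_sum_of_sq_le_mul A
      (fun x _ => div_nonneg (sq_nonneg _) (hν x).le) (fun x _ => (hν x).le)
      fun x _ => (div_mul_cancel₀ _ (hν x).ne').ge
  have hnn : ∀ x, 0 ≤ (μ x - ν x) ^ 2 / ν x := fun x => div_nonneg (sq_nonneg _) (hν x).le
  calc (∑ x ∈ A, μ x - ∑ x ∈ A, ν x) ^ 2 = (∑ x ∈ A, (μ x - ν x)) ^ 2 := by
        rw [Finset.sum_sub_distrib]
    _ ≤ (∑ x ∈ A, (μ x - ν x) ^ 2 / ν x) * 1 :=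
        hcs.trans (mul_le_mul_of_nonneg_left hA (Finset.sum_nonneg fun x _ => hnn x))
    _ ≤ ∑ x, (μ x - ν x) ^ 2 / ν x := by
        rw [mul_one]
        exact Finset.sum_le_sum_of_subset_of_nonneg (Finset.subset_univ A) fun x _ _ => hnn x
    _ = _ := hchi

/-- If a statistic has mean `m` under `μ`, second moment at most `v` under `ν`, and variance at most
`v` under `μ`, then the event that it exceeds `m / 2` tells `μ` from `ν`, by Chebyshev. -/
theorem one_sub_le_tvDist {μ ν : X → ℝ} (hμ : ∀ x, 0 ≤ μ x) (hμ1 : ∑ x, μ x = 1)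
    (hν : ∀ x, 0 ≤ ν x) (f : X → ℝ) {m v : ℝ} (hm : 0 < m) (hmean : ∑ x, μ x * f x = m)
    (hμ2 : ∑ x, μ x * f x ^ 2 ≤ v + m ^ 2) (hν2 : ∑ x, ν x * f x ^ 2 ≤ v) :
    1 - 8 * v / m ^ 2 ≤ tvDist μ ν := by
  classical
  set A : Finset X := Finset.univ.filter fun x => m / 2 ≤ f x
  have key : (4 / m ^ 2) * ((m / 2) * (m / 2)) = 1 := by
    field_simp
    norm_num
  have hνA : ∑ x ∈ A, ν x ≤ 4 / m ^ 2 * v := by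
    calc ∑ x ∈ A, ν x ≤ ∑ x ∈ A, 4 / m ^ 2 * (ν x * f x ^ 2) := by
          refine Finset.sum_le_sum fun x hx => ?_
          have hx : m / 2 ≤ f x := (Finset.mem_filter.mp hx).2
          have h1 : (m / 2) * (m / 2) ≤ f x ^ 2 := by nlinarith
          have h2 := mul_le_mul_of_nonneg_left h1 (by positivity : 0 ≤ 4 / m ^ 2)
          rw [key] at h2
          nlinarith [hν x]
      _ ≤ ∑ x, 4 / m ^ 2 * (ν x * f x ^ 2) :=
          Finset.sum_le_sum_of_subset_of_nonneg (Finset.subset_univ A) fun x _ _ =>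
            mul_nonneg (by positivity) (mul_nonneg (hν x) (sq_nonneg _))
      _ ≤ 4 / m ^ 2 * v := by
          rw [← Finset.mul_sum]
          exact mul_le_mul_of_nonneg_left hν2 (by positivity)
  have hvar : ∑ x, μ x * (f x - m) ^ 2 ≤ v := by
    have : ∀ x, μ x * (f x - m) ^ 2 = μ x * f x ^ 2 - 2 * m * (μ x * f x) + m ^ 2 * μ x :=
      fun x => by ring
    simp only [this, Finset.sum_add_distrib, Finset.sum_sub_distrib, ← Finset.mul_sum, hμ1, hmean]
    nlinarith
  have hμA : ∑ x ∈ Aᶜ, μ x ≤ 4 / m ^ 2 * v := by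
    calc ∑ x ∈ Aᶜ, μ x ≤ ∑ x ∈ Aᶜ, 4 / m ^ 2 * (μ x * (f x - m) ^ 2) := by
          refine Finset.sum_le_sum fun x hx => ?_
          have hx : f x < m / 2 := by
            simpa [A] using hx
          have h1 : (m / 2) * (m / 2) ≤ (f x - m) ^ 2 := by nlinarith
          have h2 := mul_le_mul_of_nonneg_left h1 (by positivity : 0 ≤ 4 / m ^ 2)
          rw [key] at h2
          nlinarith [hμ x]
      _ ≤ ∑ x, 4 / m ^ 2 * (μ x * (f x - m) ^ 2) :=
          Finset.sum_le_sum_of_subset_of_nonneg (Finset.subset_univ _) fun x _ _ =>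
            mul_nonneg (by positivity) (mul_nonneg (hμ x) (sq_nonneg _))
      _ ≤ 4 / m ^ 2 * v := by
          rw [← Finset.mul_sum]
          exact mul_le_mul_of_nonneg_left hvar (by positivity)
  have htot := Finset.sum_add_sum_compl A μ
  have hle := sum_sub_sum_le_tvDist μ ν A
  have : 8 * v / m ^ 2 = 2 * (4 / m ^ 2 * v) := by ring
  linarith

variable [DecidableEq X]

theorem tvDist_le_distToStationarity (P : Matrix X X ℝ) (π : X → ℝ) (t : ℕ) (x : X) :
    tvDist ((P ^ t) x) π ≤ distToStationarity P π t :=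
  le_ciSup (f := fun x : X => tvDist ((P ^ t) x) π) (Set.finite_range _).bddAbove x

theorem distToStationarity_nonneg (P : Matrix X X ℝ) (π : X → ℝ) (t : ℕ) :
    0 ≤ distToStationarity P π t :=
  Real.iSup_nonneg fun _ => tvDist_nonneg _ _

end TotalVariation

/-! ### From two-sided bounds on the distance to a cutoff with a window -/

section Cutoff

variable {d : ℕ → ℕ → ℝ} {T w : ℕ → ℝ}

/-- `d n` is within `ε` of `1` at every time before `T n - α * w n`, for `α` large enough. -/
def NearOneBefore (d : ℕ → ℕ → ℝ) (T w : ℕ → ℝ) : Prop :=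
  ∀ ε > 0, ∃ α : ℝ, ∀ᶠ n in atTop, ∀ t : ℕ, (t : ℝ) ≤ T n - α * w n → 1 - ε ≤ d n t

/-- `d n` is at most `ε` at every time after `T n + α * w n`, for `α` large enough. The time is
compared through `t + 1` so that `t = ⌊T n + α * w n⌋₊` qualifies. -/
def NearZeroAfter (d : ℕ → ℕ → ℝ) (T w : ℕ → ℝ) : Prop :=
  ∀ ε > 0, ∃ α : ℝ, ∀ᶠ n in atTop, ∀ t : ℕ, T n + α * w n ≤ t + 1 → d n t ≤ ε

/-- Every mixing time is within `O(w)` of `T`. -/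
theorem isBigO_mixingTime_sub (hw : ∀ n, 0 ≤ w n) (hT : ∀ᶠ n in atTop, 0 ≤ T n)
    (hL : NearOneBefore d T w) (hU : NearZeroAfter d T w) {ε : ℝ} (hε0 : 0 < ε) (hε1 : ε < 1) :
    (fun n => (mixingTime (d n) ε : ℝ) - T n) =O[atTop] w := by
  obtain ⟨α, hα⟩ := hL ((1 - ε) / 2) (by linarith)
  obtain ⟨β, hβ⟩ := hU ε hε0
  refine IsBigO.of_bound (max |α| |β|) ?_
  filter_upwards [hα, hβ, hT] with n hαn hβn hTn
  have hαw : α * w n ≤ max |α| |β| * w n :=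
    mul_le_mul_of_nonneg_right ((le_abs_self α).trans (le_max_left _ _)) (hw n)
  have hβw : β * w n ≤ |β| * w n := mul_le_mul_of_nonneg_right (le_abs_self β) (hw n)
  have hβw' : |β| * w n ≤ max |α| |β| * w n :=
    mul_le_mul_of_nonneg_right (le_max_right _ _) (hw n)
  have hβ0 : 0 ≤ |β| * w n := mul_nonneg (abs_nonneg β) (hw n)
  have hmem : d n ⌊T n + |β| * w n⌋₊ ≤ ε := by
    have := Nat.lt_floor_add_one (T n + |β| * w n)
    exact hβn _ (by linarith)
  have hle : (mixingTime (d n) ε : ℝ) ≤ T n + |β| * w n :=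
    (Nat.cast_le.mpr (Nat.sInf_le hmem)).trans (Nat.floor_le (by linarith))
  have hge : T n - α * w n < mixingTime (d n) ε := by
    by_contra! hcon
    have h1 := hαn _ hcon
    have h2 : d n (mixingTime (d n) ε) ≤ ε := Nat.sInf_mem (s := {t | d n t ≤ ε}) ⟨_, hmem⟩
    linarith
  rw [Real.norm_eq_abs, Real.norm_of_nonneg (hw n), abs_le]
  constructor <;> linarith

/-- The window statement holds around every sequence of times within `O(w)` of `T`. -/
theorem hasWindowAround_of_isBigO (hw : ∀ n, 0 ≤ w n) (hT : ∀ᶠ n in atTop, 0 ≤ T n)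
    (hwT : w =o[atTop] T)
    (hd0 : ∀ᶠ n in atTop, ∀ t, 0 ≤ d n t) (hd1 : ∀ᶠ n in atTop, ∀ t, d n t ≤ 1)
    (hL : NearOneBefore d T w) (hU : NearZeroAfter d T w)
    {T' : ℕ → ℝ} (hT' : (fun n => T' n - T n) =O[atTop] w) :
    HasWindowAround d T' w := by
  obtain ⟨C, hC⟩ := hT'.bound
  have hdist : ∀ᶠ n in atTop, |T' n - T n| ≤ C * w n := by
    filter_upwards [hC] with n hn
    rwa [Real.norm_eq_abs, Real.norm_of_nonneg (hw n)] at hn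
  have hequiv : T' ~[atTop] T := hT'.trans_isLittleO hwT
  have hbdd : ∀ s : ℕ → ℕ, IsBoundedUnder (· ≤ ·) atTop (fun n => d n (s n)) ∧
      IsBoundedUnder (· ≥ ·) atTop (fun n => d n (s n)) := fun s =>
    ⟨isBoundedUnder_of_eventually_le (a := 1) (hd1.mono fun n hn => hn _),
      isBoundedUnder_of_eventually_ge (a := 0) (hd0.mono fun n hn => hn _)⟩
  refine ⟨hwT.trans_isBigO hequiv.isBigO_symm, ?_, ?_⟩
  · rw [Metric.tendsto_atTop]
    intro ε hε
    obtain ⟨β, hβ⟩ := hL (ε / 2) (by linarith)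
    refine ⟨β + C, fun α hα => ?_⟩
    -- The time `0` of the truncation `⌊·⌋₊` is also before `T - β * w`, as `w = o(T)`.
    have hpos : ∀ᶠ n in atTop, 0 ≤ T n - β * w n := by
      filter_upwards [hwT.bound (c := (|β| + 1)⁻¹) (by positivity), hT] with n hn hTn
      rw [Real.norm_of_nonneg (hw n), Real.norm_of_nonneg hTn, inv_mul_eq_div,
        le_div_iff₀ (by positivity)] at hn
      nlinarith [le_abs_self β, hw n]
    have hge : ∀ᶠ n in atTop, 1 - ε / 2 ≤ d n ⌊T' n - α * w n⌋₊ := by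
      filter_upwards [hβ, hpos, hdist] with n hβn hpos hn
      refine hβn _ ?_
      have h1 := (abs_le.mp hn).2
      have h2 := mul_le_mul_of_nonneg_right hα (hw n)
      rcases le_total 0 (T' n - α * w n) with h | h
      · have := Nat.floor_le h
        linarith
      · rw [Nat.floor_of_nonpos h]
        simpa using hpos
    have h1 : 1 - ε / 2 ≤ liminf (fun n => d n ⌊T' n - α * w n⌋₊) atTop :=
      le_liminf_of_le (hbdd _).1.isCoboundedUnder_ge hge
    have h2 : liminf (fun n => d n ⌊T' n - α * w n⌋₊) atTop ≤ 1 :=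
      liminf_le_of_frequently_le (hd1.mono fun n hn => hn _).frequently (hbdd _).2
    rw [Real.dist_eq, abs_lt]
    constructor <;> linarith
  · rw [Metric.tendsto_atTop]
    intro ε hε
    obtain ⟨β, hβ⟩ := hU (ε / 2) (by linarith)
    refine ⟨β + C, fun α hα => ?_⟩
    have hle : ∀ᶠ n in atTop, d n ⌊T' n + α * w n⌋₊ ≤ ε / 2 := by
      filter_upwards [hβ, hdist] with n hβn hn
      refine hβn _ ?_
      have h1 := (abs_le.mp hn).1
      have h2 := mul_le_mul_of_nonneg_right hα (hw n)
      have := Nat.lt_floor_add_one (T' n + α * w n)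
      linarith
    have h1 : limsup (fun n => d n ⌊T' n + α * w n⌋₊) atTop ≤ ε / 2 :=
      limsup_le_of_le (hbdd _).2.isCoboundedUnder_le hle
    have h2 : 0 ≤ limsup (fun n => d n ⌊T' n + α * w n⌋₊) atTop :=
      le_limsup_of_frequently_le (hd0.mono fun n hn => hn _).frequently (hbdd _).1
    rw [Real.dist_eq, abs_lt]
    constructor <;> linarith

theorem hasCutoffAtWithWindow_of_near (hw : ∀ n, 0 ≤ w n) (hT : ∀ᶠ n in atTop, 0 < T n)
    (hwT : w =o[atTop] T)
    (hd0 : ∀ᶠ n in atTop, ∀ t, 0 ≤ d n t) (hd1 : ∀ᶠ n in atTop, ∀ t, d n t ≤ 1)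
    (hL : NearOneBefore d T w) (hU : NearZeroAfter d T w) :
    HasCutoffAtWithWindow d T w := by
  have hT0 : ∀ᶠ n in atTop, 0 ≤ T n := hT.mono fun n hn => hn.le
  have hequiv : ∀ ε : ℝ, 0 < ε → ε < 1 → (fun n => (mixingTime (d n) ε : ℝ)) ~[atTop] T :=
    fun ε h0 h1 => (isBigO_mixingTime_sub hw hT0 hL hU h0 h1).trans_isLittleO hwT
  refine ⟨fun ε h0 h1 => ?_, ?_, hequiv _ (by norm_num) (by norm_num), ?_⟩
  · have h2 := hequiv (1 - ε) (by linarith) (by linarith)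
    have hne : ∀ᶠ n in atTop, (mixingTime (d n) (1 - ε) : ℝ) ≠ 0 := by
      filter_upwards [hT, h2.isBigO_symm.eq_zero_imp] with n hn himp h
      exact hn.ne' (himp h)
    exact (isEquivalent_iff_tendsto_one hne).mp ((hequiv ε h0 h1).trans h2.symm)
  · exact hasWindowAround_of_isBigO hw hT0 hwT hd0 hd1 hL hU
      (isBigO_mixingTime_sub hw hT0 hL hU (by norm_num) (by norm_num))
  · refine hasWindowAround_of_isBigO hw hT0 hwT hd0 hd1 hL hU ?_
    simpa using isBigO_zero w atTop

end Cutoff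

/-! ### The action of the chain on functions -/

section Chain

variable {n : ℕ}

/-- The state `x` with its coordinate `i` flipped. -/
def flipAt (x : Fin n → Bool) (i : Fin n) : Fin n → Bool :=
  Function.update x i (!x i)

theorem flipAt_injective (x : Fin n → Bool) : Function.Injective (flipAt x) := by
  intro i j h
  by_contra hij
  have := congrFun h i
  simp [flipAt, hij] at this

theorem hammingDist_eq_one_iff {x z : Fin n → Bool} :
    hammingDist x z = 1 ↔ ∃ i, flipAt x i = z := by
  constructor
  · intro h
    obtain ⟨i, hi⟩ := Finset.card_eq_one.mp h
    have hmem : ∀ j, x j ≠ z j ↔ j = i := fun j => by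
      simpa using Finset.ext_iff.mp hi j
    refine ⟨i, funext fun j => ?_⟩
    by_cases hj : j = i
    · subst hj
      have := (hmem j).mpr rfl
      simp only [flipAt, Function.update_self]
      cases hx : x j <;> cases hz : z j <;> simp_all
    · have : x j = z j := by
        by_contra hne
        exact hj ((hmem j).mp hne)
      simp [flipAt, hj, this]
  · rintro ⟨i, rfl⟩
    refine Finset.card_eq_one.mpr ⟨i, Finset.ext fun j => ?_⟩
    rw [Finset.mem_filter, Finset.mem_singleton]
    by_cases hj : j = i
    · subst hj
      simp [flipAt]
    · simp [flipAt, hj]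

theorem sum_metropolisMove_mul (π : (Fin n → Bool) → ℝ) (x : Fin n → Bool)
    (g : (Fin n → Bool) → ℝ) :
    ∑ z, metropolisMove π x z * g z =
      ∑ i, 1 / (n : ℝ) * min 1 (π (flipAt x i) / π x) * g (flipAt x i) := by
  classical
  have hfilter : Finset.univ.filter (fun z => hammingDist x z = 1) =
      Finset.univ.image (flipAt x) := by
    ext z
    simp [hammingDist_eq_one_iff]
  simp only [metropolisMove, ite_mul, zero_mul]
  rw [← Finset.sum_filter, hfilter, Finset.sum_image fun i _ j _ h => flipAt_injective x h]

theorem metropolis_apply (π : (Fin n → Bool) → ℝ) (x y : Fin n → Bool) :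
    metropolis π x y =
      (if x = y then 1 - ∑ z, metropolisMove π x z else 0) + metropolisMove π x y := by
  by_cases h : x = y
  · subst h
    simp [metropolis, metropolisMove]
  · simp [metropolis, h]

theorem lazyMetropolis_mulVec (π : (Fin n → Bool) → ℝ) (g : (Fin n → Bool) → ℝ)
    (x : Fin n → Bool) :
    Matrix.mulVec (lazyMetropolis π) g x = g x +
      1 / (2 * (n : ℝ)) * ∑ i, min 1 (π (flipAt x i) / π x) * (g (flipAt x i) - g x) := by
  have h1 := sum_metropolisMove_mul π x g
  have h2 := sum_metropolisMove_mul π x fun _ => 1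
  simp only [mul_one] at h2
  have h3 : Matrix.mulVec (metropolis π) g x =
      (1 - ∑ z, metropolisMove π x z) * g x + ∑ z, metropolisMove π x z * g z := by
    simp [Matrix.mulVec, dotProduct, metropolis_apply, add_mul, Finset.sum_add_distrib, ite_mul]
  rw [lazyMetropolis, Matrix.add_mulVec, Matrix.smul_mulVec, Matrix.smul_mulVec,
    Matrix.one_mulVec]
  simp only [Pi.add_apply, Pi.smul_apply, smul_eq_mul, h3, h1, h2]
  simp only [mul_assoc, ← Finset.mul_sum, mul_sub, Finset.sum_sub_distrib, ← Finset.sum_mul]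
  ring

theorem lazyMetropolis_nonneg {π : (Fin n → Bool) → ℝ} (hπ : ∀ x, 0 < π x) (x y : Fin n → Bool) :
    0 ≤ lazyMetropolis π x y := by
  have hmove : ∀ z, 0 ≤ metropolisMove π x z := fun z => by
    unfold metropolisMove
    split_ifs
    · have := div_pos (hπ z) (hπ x)
      positivity
    · exact le_rfl
  have hsum : ∑ z, metropolisMove π x z ≤ 1 := by
    have h := sum_metropolisMove_mul π x fun _ => 1
    simp only [mul_one] at h
    rw [h]
    calc ∑ i, 1 / (n : ℝ) * min 1 (π (flipAt x i) / π x) ≤ ∑ _i : Fin n, 1 / (n : ℝ) :=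
          Finset.sum_le_sum fun i _ =>
            mul_le_of_le_one_right (by positivity) (min_le_left _ _)
      _ ≤ 1 := by
          simpa using mul_inv_le_one
  have hone : (0 : ℝ) ≤ (1 : Matrix (Fin n → Bool) (Fin n → Bool) ℝ) x y := by
    rw [Matrix.one_apply]
    split_ifs <;> norm_num
  have hmet : 0 ≤ metropolis π x y := by
    rw [metropolis_apply]
    refine add_nonneg ?_ (hmove y)
    split_ifs
    · linarith
    · exact le_rfl
  simp only [lazyMetropolis, Matrix.add_apply, Matrix.smul_apply, smul_eq_mul]
  positivity

/-! ### The product structure of the target -/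

/-- The `i`-th factor of the target distribution: Bernoulli with parameter `θ / (1 + θ)`. -/
noncomputable def siteWeight (θ : ℝ) (b : Bool) : ℝ :=
  (if b then θ else 1) / (1 + θ)

theorem siteWeight_pos {θ : ℝ} (hθ : 0 < θ) (b : Bool) : 0 < siteWeight θ b := by
  cases b <;> simp only [siteWeight] <;> positivity

theorem erTarget_eq_prod (θ : ℝ) (x : Fin n → Bool) :
    erTarget θ n x = ∏ i, siteWeight θ (x i) := by
  simp only [siteWeight]
  rw [Finset.prod_div_distrib, erTarget, numOnes, ← div_eq_mul_inv]
  simp [Finset.prod_ite]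

theorem erTarget_pos {θ : ℝ} (hθ : 0 < θ) (x : Fin n → Bool) : 0 < erTarget θ n x := by
  rw [erTarget_eq_prod]
  exact Finset.prod_pos fun i _ => siteWeight_pos hθ _

theorem min_erTarget_div {θ : ℝ} (hθ0 : 0 < θ) (hθ1 : θ ≤ 1) (x : Fin n → Bool) (i : Fin n) :
    min 1 (erTarget θ n (flipAt x i) / erTarget θ n x) = if x i then 1 else θ := by
  have hratio : erTarget θ n (flipAt x i) / erTarget θ n x =
      siteWeight θ (!x i) / siteWeight θ (x i) := by
    have hrest : ∏ j ∈ Finset.univ.erase i, siteWeight θ (flipAt x i j) =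
        ∏ j ∈ Finset.univ.erase i, siteWeight θ (x j) :=
      Finset.prod_congr rfl fun j hj => by
        simp [flipAt, Finset.ne_of_mem_erase hj]
    rw [erTarget_eq_prod, erTarget_eq_prod, ← Finset.mul_prod_erase _ _ (Finset.mem_univ i),
      ← Finset.mul_prod_erase _ (fun j => siteWeight θ (x j)) (Finset.mem_univ i), hrest,
      mul_div_mul_right _ _ (Finset.prod_pos fun j _ => siteWeight_pos hθ0 _).ne']
    simp [flipAt]
  have h1 : (1 + θ) ≠ 0 := by positivity
  rw [hratio]
  cases x i
  · have : siteWeight θ (!false) / siteWeight θ false = θ := by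
      simp [siteWeight, h1]
    rw [this, min_eq_right hθ1]
    rfl
  · have : siteWeight θ (!true) / siteWeight θ true = θ⁻¹ := by
      simp [siteWeight]
      field_simp
    rw [this, min_eq_left ((one_le_inv₀ hθ0).mpr hθ1)]
    rfl

/-! ### The spectral decomposition -/

/-- The nonconstant eigenfunction of a single site, with value `1` at `1`. It has mean zero for
`siteWeight θ`, and second moment `θ`. -/
def siteEigenfun (θ : ℝ) (b : Bool) : ℝ :=
  if b then 1 else -θ

/-- The eigenfunction of the chain indexed by a set `S` of sites. -/
def eigenfun (θ : ℝ) (S : Finset (Fin n)) (x : Fin n → Bool) : ℝ :=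
  ∏ i ∈ S, siteEigenfun θ (x i)

/-- The eigenvalue of the chain on `eigenfun θ S` for `S` of cardinality `k`. -/
noncomputable def eigenval (θ : ℝ) (n k : ℕ) : ℝ :=
  1 - k * ((1 + θ) / (2 * n))

theorem lazyMetropolis_mulVec_eigenfun {θ : ℝ} (hθ0 : 0 < θ) (hθ1 : θ ≤ 1)
    (S : Finset (Fin n)) :
    Matrix.mulVec (lazyMetropolis (erTarget θ n)) (eigenfun θ S) =
      eigenval θ n S.card • eigenfun θ S := by
  funext x
  have hterm : ∀ i, min 1 (erTarget θ n (flipAt x i) / erTarget θ n x) *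
      (eigenfun θ S (flipAt x i) - eigenfun θ S x) =
      if i ∈ S then -(1 + θ) * eigenfun θ S x else 0 := by
    intro i
    have hrest : ∏ j ∈ S.erase i, siteEigenfun θ (flipAt x i j) =
        ∏ j ∈ S.erase i, siteEigenfun θ (x j) :=
      Finset.prod_congr rfl fun j hj => by
        simp [flipAt, Finset.ne_of_mem_erase hj]
    rw [min_erTarget_div hθ0 hθ1]
    split_ifs with hx hi hi
    all_goals
      first
      | rw [eigenfun, eigenfun, ← Finset.mul_prod_erase _ _ hi,
          ← Finset.mul_prod_erase _ (fun j => siteEigenfun θ (x j)) hi, hrest]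
        simp only [flipAt, Function.update_self, siteEigenfun, hx]
        simp only [Bool.not_true, Bool.not_false, if_true, if_false,
          Bool.false_eq_true]
        ring
      | rw [Finset.erase_eq_of_notMem hi] at hrest
        rw [eigenfun, eigenfun, hrest, sub_self, mul_zero]
  rw [lazyMetropolis_mulVec, Finset.sum_congr rfl fun i _ => hterm i]
  simp only [Finset.sum_ite_mem, Finset.univ_inter, Finset.sum_const, nsmul_eq_mul, Pi.smul_apply,
    smul_eq_mul, eigenval]
  by_cases hn : (n : ℝ) = 0
  · simp [hn]
  · field_simp
    ring

theorem pow_mulVec_eigenfun {θ : ℝ} (hθ0 : 0 < θ) (hθ1 : θ ≤ 1) (S : Finset (Fin n)) (t : ℕ) :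
    Matrix.mulVec (lazyMetropolis (erTarget θ n) ^ t) (eigenfun θ S) =
      eigenval θ n S.card ^ t • eigenfun θ S := by
  induction t with
  | zero => simp
  | succ t ih =>
    rw [pow_succ, ← Matrix.mulVec_mulVec, lazyMetropolis_mulVec_eigenfun hθ0 hθ1,
      Matrix.mulVec_smul, ih, smul_smul, pow_succ, mul_comm]

theorem sum_pow_mul_eigenfun {θ : ℝ} (hθ0 : 0 < θ) (hθ1 : θ ≤ 1) (S : Finset (Fin n)) (t : ℕ)
    (x : Fin n → Bool) :
    ∑ y, (lazyMetropolis (erTarget θ n) ^ t) x y * eigenfun θ S y =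
      eigenval θ n S.card ^ t * eigenfun θ S x :=
  congrFun (pow_mulVec_eigenfun hθ0 hθ1 S t) x

theorem sum_pow {θ : ℝ} (hθ0 : 0 < θ) (hθ1 : θ ≤ 1) (t : ℕ) (x : Fin n → Bool) :
    ∑ y, (lazyMetropolis (erTarget θ n) ^ t) x y = 1 := by
  simpa [eigenfun, eigenval] using sum_pow_mul_eigenfun hθ0 hθ1 ∅ t x

theorem pow_nonneg_apply {θ : ℝ} (hθ0 : 0 < θ) (t : ℕ) (x y : Fin n → Bool) :
    0 ≤ (lazyMetropolis (erTarget θ n) ^ t) x y := by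
  induction t generalizing y with
  | zero =>
    rw [pow_zero, Matrix.one_apply]
    split_ifs <;> norm_num
  | succ t ih =>
    rw [pow_succ, Matrix.mul_apply]
    exact Finset.sum_nonneg fun z _ =>
      mul_nonneg (ih z) (lazyMetropolis_nonneg (erTarget_pos hθ0) z y)

theorem sum_erTarget_mul_eigenfun {θ : ℝ} (hθ0 : 0 < θ) (S : Finset (Fin n)) :
    ∑ y, erTarget θ n y * eigenfun θ S y = if S = ∅ then 1 else 0 := by
  classical
  have hprod : ∀ y : Fin n → Bool, erTarget θ n y * eigenfun θ S y =
      ∏ i, siteWeight θ (y i) * (if i ∈ S then siteEigenfun θ (y i) else 1) := fun y => by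
    rw [erTarget_eq_prod, eigenfun, Finset.prod_mul_distrib, Finset.prod_ite_mem,
      Finset.univ_inter]
  have h1 : (1 + θ) ≠ 0 := by positivity
  have hsite : ∀ i, ∑ b, siteWeight θ b * (if i ∈ S then siteEigenfun θ b else 1) =
      if i ∈ S then 0 else 1 := fun i => by
    by_cases hi : i ∈ S <;> simp [siteWeight, siteEigenfun, hi] <;> field_simp <;> ring
  simp only [hprod]
  rw [← Fintype.prod_sum fun i b => siteWeight θ b * (if i ∈ S then siteEigenfun θ b else 1)]
  simp only [hsite]
  split_ifs with hS
  · simp [hS]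
  · obtain ⟨i, hi⟩ := Finset.nonempty_iff_ne_empty.mpr hS
    exact Finset.prod_eq_zero (Finset.mem_univ i) (by simp [hi])

theorem sum_erTarget {θ : ℝ} (hθ0 : 0 < θ) : ∑ y, erTarget θ n y = 1 := by
  simpa [eigenfun] using sum_erTarget_mul_eigenfun hθ0 (∅ : Finset (Fin n))

/-- The eigenfunctions are complete; the sum over `S` factorizes over the sites. -/
theorem sum_eigenfun_mul_eigenfun {θ : ℝ} (hθ0 : 0 < θ) (x y : Fin n → Bool) :
    ∑ S : Finset (Fin n), eigenfun θ S x * eigenfun θ S y * θ⁻¹ ^ S.card * erTarget θ n y =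
      if x = y then 1 else 0 := by
  classical
  have hS : ∀ S : Finset (Fin n), eigenfun θ S x * eigenfun θ S y * θ⁻¹ ^ S.card =
      ∏ i ∈ S, siteEigenfun θ (x i) * siteEigenfun θ (y i) * θ⁻¹ := fun S => by
    simp [eigenfun, Finset.prod_mul_distrib]
  have h1 : (1 + θ) ≠ 0 := by positivity
  have hsite : ∀ a b : Bool, (1 + siteEigenfun θ a * siteEigenfun θ b * θ⁻¹) * siteWeight θ b =
      if a = b then 1 else 0 := fun a b => by
    cases a <;> cases b <;> simp [siteEigenfun, siteWeight] <;> field_simp <;> simp [add_comm]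
  rw [← Finset.sum_mul]
  simp only [hS]
  rw [← Finset.powerset_univ, ← Finset.prod_one_add, erTarget_eq_prod, ← Finset.prod_mul_distrib]
  simp only [hsite]
  split_ifs with hxy
  · simp [hxy]
  · obtain ⟨i, hi⟩ := Function.ne_iff.mp hxy
    exact Finset.prod_eq_zero (Finset.mem_univ i) (by simp [hi])

theorem pow_apply_eq_sum {θ : ℝ} (hθ0 : 0 < θ) (hθ1 : θ ≤ 1) (t : ℕ) (x y : Fin n → Bool) :
    (lazyMetropolis (erTarget θ n) ^ t) x y = ∑ S : Finset (Fin n),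
      eigenval θ n S.card ^ t * (eigenfun θ S x * eigenfun θ S y * θ⁻¹ ^ S.card) *
        erTarget θ n y := by
  classical
  calc (lazyMetropolis (erTarget θ n) ^ t) x y
      = ∑ z, (lazyMetropolis (erTarget θ n) ^ t) x z * if z = y then 1 else 0 := by simp
    _ = ∑ z, ∑ S : Finset (Fin n), (lazyMetropolis (erTarget θ n) ^ t) x z * eigenfun θ S z *
          (eigenfun θ S y * θ⁻¹ ^ S.card * erTarget θ n y) := by
        refine Finset.sum_congr rfl fun z _ => ?_
        rw [← sum_eigenfun_mul_eigenfun hθ0, Finset.mul_sum]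
        exact Finset.sum_congr rfl fun S _ => by ring
    _ = _ := by
        rw [Finset.sum_comm]
        refine Finset.sum_congr rfl fun S _ => ?_
        rw [← Finset.sum_mul, sum_pow_mul_eigenfun hθ0 hθ1]
        ring

theorem pow_reversible {θ : ℝ} (hθ0 : 0 < θ) (hθ1 : θ ≤ 1) (t : ℕ) (x y : Fin n → Bool) :
    erTarget θ n x * (lazyMetropolis (erTarget θ n) ^ t) x y =
      erTarget θ n y * (lazyMetropolis (erTarget θ n) ^ t) y x := by
  rw [pow_apply_eq_sum hθ0 hθ1, pow_apply_eq_sum hθ0 hθ1, Finset.mul_sum, Finset.mul_sum]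
  exact Finset.sum_congr rfl fun S _ => by ring

/-- The `χ²`-divergence from stationarity at time `t` is a return probability at time `2 * t`,
by reversibility, and the spectral decomposition expresses it through the eigenvalues. -/
theorem sum_pow_sq_div {θ : ℝ} (hθ0 : 0 < θ) (hθ1 : θ ≤ 1) (t : ℕ) (x : Fin n → Bool) :
    ∑ y, (lazyMetropolis (erTarget θ n) ^ t) x y ^ 2 / erTarget θ n y =
      ∑ S : Finset (Fin n), eigenval θ n S.card ^ (2 * t) * (eigenfun θ S x ^ 2 * θ⁻¹ ^ S.card) := by
  have hx := (erTarget_pos hθ0 x).ne'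
  have hterm : ∀ y, (lazyMetropolis (erTarget θ n) ^ t) x y ^ 2 / erTarget θ n y =
      (lazyMetropolis (erTarget θ n) ^ t) x y * (lazyMetropolis (erTarget θ n) ^ t) y x /
        erTarget θ n x := fun y => by
    have hy := (erTarget_pos hθ0 y).ne'
    have := pow_reversible hθ0 hθ1 t x y
    field_simp
    rw [sq, mul_assoc, mul_assoc, mul_comm _ (erTarget θ n x), this]
  simp only [hterm]
  rw [← Finset.sum_div, ← Matrix.mul_apply, ← pow_add, ← two_mul, pow_apply_eq_sum hθ0 hθ1,
    ← Finset.sum_mul, mul_div_assoc, div_self hx, mul_one]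
  simp only [sq]

end Chain

/-! ### Bounds on the distance to stationarity -/

section Bounds

variable {n : ℕ}

theorem distToStationarity_le_one {θ : ℝ} (hθ0 : 0 < θ) (hθ1 : θ ≤ 1) (t : ℕ) :
    distToStationarity (lazyMetropolis (erTarget θ n)) (erTarget θ n) t ≤ 1 :=
  ciSup_le fun x => tvDist_le_one (pow_nonneg_apply hθ0 t x) (sum_pow hθ0 hθ1 t x)
    fun y => (erTarget_pos hθ0 y).le

theorem siteEigenfun_sq_le_one {θ : ℝ} (hθ0 : 0 < θ) (hθ1 : θ ≤ 1) (b : Bool) :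
    siteEigenfun θ b ^ 2 ≤ 1 := by
  cases b
  · simpa [siteEigenfun, abs_of_pos hθ0] using hθ1
  · simp [siteEigenfun]

theorem eigenfun_sq_le_one {θ : ℝ} (hθ0 : 0 < θ) (hθ1 : θ ≤ 1) (S : Finset (Fin n))
    (x : Fin n → Bool) : eigenfun θ S x ^ 2 ≤ 1 := by
  rw [eigenfun, ← Finset.prod_pow]
  exact Finset.prod_le_one (fun _ _ => sq_nonneg _) fun _ _ => siteEigenfun_sq_le_one hθ0 hθ1 _

theorem eigenval_nonneg {θ : ℝ} (hθ1 : θ ≤ 1) {k : ℕ} (hk : k ≤ n) : 0 ≤ eigenval θ n k := by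
  rcases Nat.eq_zero_or_pos n with rfl | hn
  · simp [eigenval]
  · have hn' : (0 : ℝ) < n := by exact_mod_cast hn
    have hk' : (k : ℝ) ≤ n := by exact_mod_cast hk
    have hk0 : (0 : ℝ) ≤ k := k.cast_nonneg
    have : (k : ℝ) * ((1 + θ) / (2 * n)) ≤ 1 := by
      rw [← mul_div_assoc, div_le_one (by positivity)]
      nlinarith
    rw [eigenval]
    linarith

theorem eigenval_pow_le {θ : ℝ} (hθ1 : θ ≤ 1) {k : ℕ} (hk : k ≤ n) (t : ℕ) :
    eigenval θ n k ^ (2 * t) ≤ Real.exp (-((1 + θ) * t / n)) ^ k := by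
  have h : eigenval θ n k ≤ Real.exp (-(k * ((1 + θ) / (2 * n)))) := by
    have := Real.add_one_le_exp (-(k * ((1 + θ) / (2 * n))))
    rw [eigenval]
    linarith
  refine (pow_le_pow_left₀ (eigenval_nonneg hθ1 hk) h _).trans_eq ?_
  rw [← Real.exp_nat_mul, ← Real.exp_nat_mul]
  congr 1
  push_cast
  rcases Nat.eq_zero_or_pos n with rfl | hn
  · simp
  · field_simp

/-- The `L²` upper bound: the sum over `S` of the bounds for `eigenval θ n S.card ^ (2 * t)` is a
binomial sum. -/
theorem distToStationarity_le_sqrt {θ : ℝ} (hθ0 : 0 < θ) (hθ1 : θ ≤ 1) (t : ℕ) :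
    distToStationarity (lazyMetropolis (erTarget θ n)) (erTarget θ n) t ≤
      √(Real.exp (n * (Real.exp (-((1 + θ) * t / n)) / θ)) - 1) := by
  refine ciSup_le fun x => (tvDist_le_sqrt (sum_pow hθ0 hθ1 t x) (erTarget_pos hθ0)
    (sum_erTarget hθ0)).trans (Real.sqrt_le_sqrt (sub_le_sub_right ?_ 1))
  set q := Real.exp (-((1 + θ) * t / n))
  have hq : 0 < q := Real.exp_pos _
  rw [sum_pow_sq_div hθ0 hθ1]
  calc ∑ S : Finset (Fin n), eigenval θ n S.card ^ (2 * t) * (eigenfun θ S x ^ 2 * θ⁻¹ ^ S.card)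
      ≤ ∑ S : Finset (Fin n), (q / θ) ^ S.card := by
        refine Finset.sum_le_sum fun S _ => ?_
        have hS : S.card ≤ n := by simpa using Finset.card_le_univ S
        rw [div_eq_mul_inv, mul_pow]
        refine mul_le_mul (eigenval_pow_le hθ1 hS t) ?_ (by positivity) (by positivity)
        exact mul_le_of_le_one_left (by positivity) (eigenfun_sq_le_one hθ0 hθ1 S x)
    _ = (q / θ + 1) ^ n := by
        simpa using Fin.sum_pow_mul_eq_add_pow (n := n) (q / θ) 1
    _ ≤ Real.exp (q / θ) ^ n :=
        pow_le_pow_left₀ (by positivity) (Real.add_one_le_exp _) n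
    _ = _ := (Real.exp_nat_mul _ _).symm

/-- The second moment of `∑ i, siteEigenfun θ (x i)` in terms of its pair correlations. -/
theorem sum_mul_sum_siteEigenfun_sq_le {θ : ℝ} (hθ0 : 0 < θ) (hθ1 : θ ≤ 1)
    {μ : (Fin n → Bool) → ℝ} (hμ : ∀ x, 0 ≤ μ x) (hμ1 : ∑ x, μ x = 1) {c : ℝ} (hc : 0 ≤ c)
    (hpair : ∀ i j, i ≠ j → ∑ x, μ x * eigenfun θ {i, j} x ≤ c) :
    ∑ x, μ x * (∑ i, siteEigenfun θ (x i)) ^ 2 ≤ n + n ^ 2 * c := by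
  have hij : ∀ i j, ∑ x, μ x * (siteEigenfun θ (x i) * siteEigenfun θ (x j)) ≤
      (if i = j then 1 else 0) + c := fun i j => by
    split_ifs with h
    · subst h
      have : ∑ x, μ x * (siteEigenfun θ (x i) * siteEigenfun θ (x i)) ≤ ∑ x, μ x :=
        Finset.sum_le_sum fun x _ => mul_le_of_le_one_right (hμ x) <| by
          rw [← sq]
          exact siteEigenfun_sq_le_one hθ0 hθ1 _
      linarith
    · rw [zero_add]
      simpa [eigenfun, Finset.prod_pair h] using hpair i j h
  calc ∑ x, μ x * (∑ i, siteEigenfun θ (x i)) ^ 2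
      = ∑ i, ∑ j, ∑ x, μ x * (siteEigenfun θ (x i) * siteEigenfun θ (x j)) := by
        simp only [sq, Finset.sum_mul_sum]
        simp only [Finset.mul_sum]
        rw [Finset.sum_comm]
        exact Finset.sum_congr rfl fun i _ => Finset.sum_comm
    _ ≤ ∑ i : Fin n, ∑ j : Fin n, ((if i = j then 1 else 0) + c) :=
        Finset.sum_le_sum fun i _ => Finset.sum_le_sum fun j _ => hij i j
    _ = n + n ^ 2 * c := by
        simp [Finset.sum_add_distrib]
        ring

/-- The second moment lower bound, for the chain started at the all-ones state and the sum of the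
eigenfunctions of the sites. -/
theorem one_sub_le_distToStationarity {θ : ℝ} (hθ0 : 0 < θ) (hθ1 : θ ≤ 1) (hn : 2 ≤ n) (t : ℕ) :
    1 - 8 / (n * eigenval θ n 1 ^ (2 * t)) ≤
      distToStationarity (lazyMetropolis (erTarget θ n)) (erTarget θ n) t := by
  have hn' : (2 : ℝ) ≤ n := by exact_mod_cast hn
  have hlam : 0 < eigenval θ n 1 := by
    have : (1 + θ) / (2 * n) < 1 := by
      rw [div_lt_one (by positivity)]
      linarith
    rw [eigenval]
    push_cast
    linarith
  have hone : ∀ S : Finset (Fin n), eigenfun θ S (fun _ => true) = 1 := fun S => by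
    simp [eigenfun, siteEigenfun]
  refine le_trans ?_ (tvDist_le_distToStationarity _ _ t fun _ => true)
  have hmean : ∑ x, (lazyMetropolis (erTarget θ n) ^ t) (fun _ => true) x *
      ∑ i, siteEigenfun θ (x i) = n * eigenval θ n 1 ^ t := by
    have hi : ∀ i : Fin n, ∑ x, (lazyMetropolis (erTarget θ n) ^ t) (fun _ => true) x *
        siteEigenfun θ (x i) = eigenval θ n 1 ^ t := fun i => by
      simpa [eigenfun, siteEigenfun] using sum_pow_mul_eigenfun hθ0 hθ1 {i} t fun _ => true
    simp only [Finset.mul_sum]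
    rw [Finset.sum_comm]
    simp [hi]
  have hlam2 : eigenval θ n 2 ≤ eigenval θ n 1 ^ 2 := by
    simp only [eigenval]
    push_cast
    nlinarith [sq_nonneg ((1 + θ) / (2 * (n : ℝ)))]
  have hμ2 : ∑ x, (lazyMetropolis (erTarget θ n) ^ t) (fun _ => true) x *
      (∑ i, siteEigenfun θ (x i)) ^ 2 ≤ n + (n * eigenval θ n 1 ^ t) ^ 2 := by
    have := sum_mul_sum_siteEigenfun_sq_le hθ0 hθ1
      (pow_nonneg_apply hθ0 t fun _ => true) (sum_pow hθ0 hθ1 t fun _ => true)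
      (c := (eigenval θ n 1 ^ 2) ^ t) (by positivity) fun i j hij => by
        rw [sum_pow_mul_eigenfun hθ0 hθ1, hone, Finset.card_pair hij, mul_one]
        exact pow_le_pow_left₀ (eigenval_nonneg hθ1 hn) hlam2 t
    rwa [mul_pow, ← pow_mul, mul_comm t 2, pow_mul]
  have hν2 : ∑ x, erTarget θ n x * (∑ i, siteEigenfun θ (x i)) ^ 2 ≤ n := by
    simpa using sum_mul_sum_siteEigenfun_sq_le hθ0 hθ1 (fun x => (erTarget_pos hθ0 x).le)
      (sum_erTarget hθ0) (c := 0) le_rfl fun i j _ => by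
        rw [sum_erTarget_mul_eigenfun hθ0, if_neg (Finset.insert_ne_empty _ _)]
  refine le_trans (le_of_eq ?_) (one_sub_le_tvDist (pow_nonneg_apply hθ0 t fun _ => true)
    (sum_pow hθ0 hθ1 t fun _ => true) (fun x => (erTarget_pos hθ0 x).le)
    (fun x => ∑ i, siteEigenfun θ (x i)) (by positivity) hmean hμ2 hν2)
  rw [mul_pow, ← pow_mul, mul_comm t 2]
  field_simp

/-! ### The two bounds around `n log n / (1 + θ)` -/

theorem distToStationarity_le_of_le {θ α : ℝ} (hθ0 : 0 < θ) (hθ1 : θ ≤ 1) (hn : 1 ≤ n)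
    (hα : 0 ≤ α) {t : ℕ} (ht : 1 / (1 + θ) * (n * Real.log n) + α * n ≤ t + 1) :
    distToStationarity (lazyMetropolis (erTarget θ n)) (erTarget θ n) t ≤
      √(Real.exp (Real.exp (2 - α) / θ) - 1) := by
  refine (distToStationarity_le_sqrt hθ0 hθ1 t).trans
    (Real.sqrt_le_sqrt (sub_le_sub_right (Real.exp_le_exp.mpr ?_) 1))
  have hn' : (1 : ℝ) ≤ n := by exact_mod_cast hn
  have hexp : Real.log n - (1 + θ) * t / n ≤ 2 - α := by
    have h1 : n * Real.log n + (1 + θ) * (α * n) ≤ (1 + θ) * (t + 1) := by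
      have := mul_le_mul_of_nonneg_left ht (by positivity : 0 ≤ 1 + θ)
      field_simp at this
      linarith
    rw [sub_le_iff_le_add, ← sub_le_iff_le_add', le_div_iff₀ (by positivity)]
    nlinarith [mul_nonneg hθ0.le (mul_nonneg hα (by positivity : (0 : ℝ) ≤ n))]
  rw [← mul_div_assoc]
  refine div_le_div_of_nonneg_right ?_ hθ0.le
  calc (n : ℝ) * Real.exp (-((1 + θ) * t / n)) = Real.exp (Real.log n - (1 + θ) * t / n) := by
        rw [sub_eq_add_neg, Real.exp_add, Real.exp_log (by positivity)]
    _ ≤ _ := Real.exp_le_exp.mpr hexp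

theorem le_distToStationarity_of_le {θ α : ℝ} (hθ0 : 0 < θ) (hθ1 : θ ≤ 1) (hn : 2 ≤ n)
    (hα : 0 ≤ α) {t : ℕ} (ht : (t : ℝ) ≤ 1 / (1 + θ) * (n * Real.log n) - α * n) :
    1 - 8 * Real.exp (1 - α) ≤
      distToStationarity (lazyMetropolis (erTarget θ n)) (erTarget θ n) t := by
  have hn' : (2 : ℝ) ≤ n := by exact_mod_cast hn
  refine le_trans (sub_le_sub_left ?_ 1) (one_sub_le_distToStationarity hθ0 hθ1 hn t)
  have hlogn : Real.log n ≤ n - 1 := Real.log_le_sub_one_of_pos (by positivity)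
  set r := Real.log n - (1 + θ) * α
  have htr : (1 + θ) * t ≤ n * r := by
    have := mul_le_mul_of_nonneg_left ht (by positivity : 0 ≤ 1 + θ)
    field_simp at this
    simp only [r]
    linarith
  -- `1 - x ≥ exp (-(x / (1 - x)))` for `x = (1 + θ) / (2 * n)`
  have hlam : Real.exp (-((1 + θ) / (2 * n - (1 + θ)))) ≤ eigenval θ n 1 := by
    have hpos : 0 < 2 * (n : ℝ) - (1 + θ) := by linarith
    have h := Real.add_one_le_exp ((1 + θ) / (2 * n - (1 + θ)))
    have heq : eigenval θ n 1 = ((1 + θ) / (2 * n - (1 + θ)) + 1)⁻¹ := by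
      have : 2 * (n : ℝ) - (1 + θ) ≠ 0 := hpos.ne'
      simp only [eigenval]
      push_cast
      rw [div_add_one this]
      field_simp
      ring
    rw [heq, Real.exp_neg]
    exact inv_anti₀ (by positivity) h
  have hexp : (2 * t : ℝ) * ((1 + θ) / (2 * n - (1 + θ))) ≤ r + 1 := by
    have hpos : 0 < 2 * (n : ℝ) - (1 + θ) := by linarith
    rw [← mul_div_assoc, div_le_iff₀ hpos]
    have hr : r ≤ n - 1 := by
      have : 0 ≤ (1 + θ) * α := by positivity
      simp only [r]
      linarith
    have hr0 : 0 ≤ r := by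
      have : 0 ≤ n * r := le_trans (by positivity) htr
      exact nonneg_of_mul_nonneg_right this (by positivity)
    nlinarith
  have hmain : Real.exp (α - 1) ≤ n * eigenval θ n 1 ^ (2 * t) := by
    calc Real.exp (α - 1) ≤ Real.exp (Real.log n - (r + 1)) := by
          refine Real.exp_le_exp.mpr ?_
          simp only [r]
          nlinarith [mul_nonneg hθ0.le hα]
      _ ≤ Real.exp (Real.log n + (2 * t : ℕ) * -((1 + θ) / (2 * n - (1 + θ)))) := by
          refine Real.exp_le_exp.mpr ?_
          push_cast
          linarith
      _ ≤ n * eigenval θ n 1 ^ (2 * t) := by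
          rw [Real.exp_add, Real.exp_log (by positivity), Real.exp_nat_mul]
          gcongr
  rw [show (1 - α) = -(α - 1) by ring, Real.exp_neg, ← div_eq_mul_inv]
  gcongr

end Bounds

/-! ### Cutoff of the Metropolis chain -/

theorem nearOneBefore_lazyMetropolis {θ : ℝ} (hθ0 : 0 < θ) (hθ1 : θ ≤ 1) :
    NearOneBefore
      (fun n : ℕ => distToStationarity (lazyMetropolis (erTarget θ n)) (erTarget θ n))
      (fun n : ℕ => 1 / (1 + θ) * (n * Real.log n)) (fun n : ℕ => (n : ℝ)) := by
  intro ε hε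
  have hlim : Tendsto (fun α : ℝ => 8 * Real.exp (1 - α)) atTop (𝓝 0) := by
    simpa [sub_eq_add_neg] using (Real.tendsto_exp_atBot.comp
      (tendsto_atBot_add_const_left atTop (1 : ℝ) tendsto_neg_atTop_atBot)).const_mul 8
  obtain ⟨α, hαε, hα⟩ := ((hlim.eventually_le_const hε).and (eventually_ge_atTop 0)).exists
  refine ⟨α, ?_⟩
  filter_upwards [eventually_ge_atTop 2] with n hn t ht
  have := le_distToStationarity_of_le hθ0 hθ1 hn hα ht
  linarith

theorem nearZeroAfter_lazyMetropolis {θ : ℝ} (hθ0 : 0 < θ) (hθ1 : θ ≤ 1) :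
    NearZeroAfter
      (fun n : ℕ => distToStationarity (lazyMetropolis (erTarget θ n)) (erTarget θ n))
      (fun n : ℕ => 1 / (1 + θ) * (n * Real.log n)) (fun n : ℕ => (n : ℝ)) := by
  intro ε hε
  have hexp : Tendsto (fun α : ℝ => Real.exp (2 - α) / θ) atTop (𝓝 0) := by
    simpa [sub_eq_add_neg] using (Real.tendsto_exp_atBot.comp
      (tendsto_atBot_add_const_left atTop (2 : ℝ) tendsto_neg_atTop_atBot)).div_const θ
  have hlim : Tendsto (fun α : ℝ => √(Real.exp (Real.exp (2 - α) / θ) - 1)) atTop (𝓝 0) := by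
    have hcont : Continuous fun u : ℝ => √(Real.exp u - 1) := by fun_prop
    simpa [Function.comp_def] using (hcont.tendsto 0).comp hexp
  obtain ⟨α, hαε, hα⟩ := ((hlim.eventually_le_const hε).and (eventually_ge_atTop 0)).exists
  refine ⟨α, ?_⟩
  filter_upwards [eventually_ge_atTop 1] with n hn t ht
  exact (distToStationarity_le_of_le hθ0 hθ1 hn hα ht).trans hαε

theorem natCast_isLittleO_mul_log {c : ℝ} (hc : c ≠ 0) :
    (fun n : ℕ => (n : ℝ)) =o[atTop] fun n : ℕ => c * (n * Real.log n) := by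
  have hlog : (fun _ : ℕ => (1 : ℝ)) =o[atTop] fun n : ℕ => Real.log n :=
    (Real.isLittleO_const_log_atTop (c := (1 : ℝ))).comp_tendsto tendsto_natCast_atTop_atTop
  have h := (isBigO_refl (fun n : ℕ => (n : ℝ)) atTop).mul_isLittleO hlog
  simp only [mul_one] at h
  exact h.const_mul_right hc

theorem theorem1 (θ : ℝ) (hθ0 : 0 < θ) (hθ1 : θ ≤ 1) :
    HasCutoffAtWithWindow
      (fun n : ℕ => distToStationarity (lazyMetropolis (erTarget θ n)) (erTarget θ n))
      (fun n : ℕ => 1 / (1 + θ) * (n * Real.log n))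
      (fun n : ℕ => (n : ℝ)) := by
  refine hasCutoffAtWithWindow_of_near (fun n => n.cast_nonneg) ?_
    (natCast_isLittleO_mul_log (by positivity))
    (Eventually.of_forall fun n t => distToStationarity_nonneg _ _ t)
    (Eventually.of_forall fun n t => distToStationarity_le_one hθ0 hθ1 t)
    (nearOneBefore_lazyMetropolis hθ0 hθ1) (nearZeroAfter_lazyMetropolis hθ0 hθ1)
  filter_upwards [eventually_ge_atTop 2] with n hn
  have hn' : (1 : ℝ) < n := by exact_mod_cast hn
  have := Real.log_pos hn'
  positivity
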